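/- Let $d\in\mathbb N$ and let $\mathbb H^2_d=\ell^2(\mathbb F^d)$ be the full Fock space, with orthonormal basis $(e_\alpha)$ indexed by the words $\alpha$ in the letters $1,\dots,d$ and vacuum vector $1=e_\emptyset$. Let $L_1,\dots,L_d$ be the left free shifts, $L_ke_\alpha=e_{k\alpha}$; let $\mathcal A_d$ (the free disk algebra) be the operator-norm closed unital algebra generated by $L_1,\dots,L_d$, and let $\mathscr A_d=(\mathcal A_d+\mathcal A_d^*)^{-\|\cdot\|}$ (the free disk system); one has $\mathcal A_d^*\mathcal A_d\subseteq\mathscr A_d$. An NC measure is a positive linear functional on $\mathscr A_d$; NC Lebesgue measure is the vacuum state $m(T)=\langle 1,T1\rangle$. For an NC measure $\mu$, the GNS space $\mathbb H^2_d(\mu)$ is the Hilbert space completion of $\mathcal A_d$, modulo vectors of zero length, for the pre-inner product $\langle a,b\rangle_\mu=\mu(a^*b)$; the class of $a$ is written $a+N_\mu$. Via the injection $a\mapsto a1$, regard $\mathcal A_d$ as a dense subspace of $\mathbb H^2_d$, and let $q_\mu$ be the positive semi-definite form $q_\mu(a,b)=\mu(a^*b)$ with domain $\mathcal A_d$. For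 densely defined positive semi-definite forms $p,q$ in a Hilbert space, $p\le q$ means that $\operatorname{Dom}q\subseteq\operatorname{Dom}p$ and $p(h,h)\le q(h,h)$ for all $h\in\operatorname{Dom}q$; $q$ is closed if $\operatorname{Dom}q$ is complete in the norm $(q(h,h)+\|h\|^2)^{1/2}$, and closable if it has a closed extension. The measure $\mu$ is singular (with respect to $m$) if the maximal closable positive semi-definite form bounded above by $q_\mu$ vanishes identically. Then an NC measure $\mu$ is singular if and only if $\mathbb H^2_d(\mu+m)=\mathbb H^2_d(\mu)\oplus\mathbb H^2_d$ (orthogonal direct sum) in the canonical way, that is, if and only if the map $$a+N_{\mu+m}\ \longmapsto\ (a+N_\mu)\oplus a1,\qquad a\in\mathcal A_d,$$ extends to a unitary operator from $\mathbb H^2_d(\mu+m)$ onto $\mathbb H^2_d(\mu)\oplus\mathbb H^2_d$. -/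

import Mathlib

open scoped ComplexOrder InnerProductSpace

namespace NCMeas

/-! ### The full Fock space and the left free shifts -/

/-- The full Fock space `ℓ²(𝔽^d)`: square-summable families indexed by the words in `d` letters
(the free monoid on `d` letters, with the empty word `[]` as unit). -/
abbrev Fock (d : ℕ) : Type := lp (fun _ : List (Fin d) => ℂ) 2

/-- The orthonormal basis vector `e_w`. -/
noncomputable def basisVec {d : ℕ} (w : List (Fin d)) : Fock d := lp.single 2 w 1

/-- The vacuum vector `1 = e_∅`. -/
noncomputable def vacuum (d : ℕ) : Fock d := basisVec []

theorem extend_sq_hasSum {d : ℕ} {σ : List (Fin d) → List (Fin d)}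
    (hσ : Function.Injective σ) (f : Fock d) :
    HasSum (fun w => ‖Function.extend σ (f : List (Fin d) → ℂ) 0 w‖ ^ (2 : ENNReal).toReal)
      (‖f‖ ^ (2 : ENNReal).toReal) := by
  have h := lp.hasSum_norm (p := 2) (by norm_num) f
  rw [← hσ.hasSum_iff (f := fun w =>
    ‖Function.extend σ (f : List (Fin d) → ℂ) 0 w‖ ^ (2 : ENNReal).toReal)]
  · simpa [Function.comp_def, hσ.extend_apply] using h
  · intro w hw
    rw [Function.extend_apply' _ _ _ (by simpa using hw)]
    simp

/-- For an injective map `σ` of words, the isometry of the Fock space with `e_w ↦ e_{σ w}`. -/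
noncomputable def wordIsometry {d : ℕ} (σ : List (Fin d) → List (Fin d))
    (hσ : Function.Injective σ) : Fock d →ₗᵢ[ℂ] Fock d where
  toFun f := ⟨Function.extend σ (f : List (Fin d) → ℂ) 0,
    memℓp_gen (extend_sq_hasSum hσ f).summable⟩
  map_add' f g := by
    ext w
    by_cases hw : ∃ v, σ v = w
    · obtain ⟨v, rfl⟩ := hw
      simp only [lp.coeFn_add, Pi.add_apply, hσ.extend_apply]
    · simp only [lp.coeFn_add, Pi.add_apply, Function.extend_apply' _ _ _ hw, Pi.zero_apply,
        add_zero]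
  map_smul' c f := by
    ext w
    by_cases hw : ∃ v, σ v = w
    · obtain ⟨v, rfl⟩ := hw
      simp [hσ.extend_apply]
    · simp [Function.extend_apply' _ _ _ hw]
  norm_map' f := by
    have h1 := lp.hasSum_norm (p := 2) (by norm_num)
      (⟨Function.extend σ (f : List (Fin d) → ℂ) 0,
        memℓp_gen (extend_sq_hasSum hσ f).summable⟩ : Fock d)
    have h2 := h1.unique (extend_sq_hasSum hσ f)
    simpa using h2

theorem wordIsometry_apply {d : ℕ} {σ : List (Fin d) → List (Fin d)}
    (hσ : Function.Injective σ) (f : Fock d) (w : List (Fin d)) :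
    wordIsometry σ hσ f (σ w) = f w := hσ.extend_apply _ _ _

theorem wordIsometry_apply_of_notMem {d : ℕ} {σ : List (Fin d) → List (Fin d)}
    (hσ : Function.Injective σ) (f : Fock d) {w : List (Fin d)} (hw : ¬ ∃ v, σ v = w) :
    wordIsometry σ hσ f w = 0 := Function.extend_apply' _ _ _ hw

theorem wordIsometry_basisVec {d : ℕ} {σ : List (Fin d) → List (Fin d)}
    (hσ : Function.Injective σ) (w : List (Fin d)) :
    wordIsometry σ hσ (basisVec w) = basisVec (σ w) := by
  ext v
  by_cases hv : ∃ u, σ u = v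
  · obtain ⟨u, rfl⟩ := hv
    rw [wordIsometry_apply]
    simp [basisVec, lp.single_apply, Pi.single_apply, hσ.eq_iff]
  · rw [wordIsometry_apply_of_notMem hσ _ hv]
    have : v ≠ σ w := fun h => hv ⟨w, h.symm⟩
    simp [basisVec, lp.single_apply, this]

/-- The left free shift `L_k`, with `L_k e_w = e_{kw}`. -/
noncomputable def leftShift {d : ℕ} (k : Fin d) : Fock d →L[ℂ] Fock d :=
  (wordIsometry (fun w => k :: w) (List.cons_injective)).toContinuousLinearMap

theorem leftShift_basisVec {d : ℕ} (k : Fin d) (w : List (Fin d)) :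
    leftShift k (basisVec w) = basisVec (k :: w) :=
  wordIsometry_basisVec List.cons_injective w

/-- `L_k^* L_j = δ_{kj} I`. -/
theorem star_leftShift_mul {d : ℕ} (k j : Fin d) :
    star (leftShift k) * leftShift j = if k = j then 1 else 0 := by
  split_ifs with h
  · subst h
    rw [ContinuousLinearMap.star_eq_adjoint]
    refine (ContinuousLinearMap.norm_map_iff_adjoint_comp_self _).1 fun x => ?_
    exact (wordIsometry (fun w => k :: w) (List.cons_injective)).norm_map x
  · ext1 x
    refine ext_inner_left ℂ fun y => ?_
    rw [ContinuousLinearMap.star_eq_adjoint, mul_apply_eq_comp,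
      ContinuousLinearMap.adjoint_inner_right]
    rw [lp.inner_eq_tsum]
    have : ∀ w : List (Fin d), ⟪(leftShift k y) w, (leftShift j x) w⟫_ℂ = 0 := by
      intro w
      by_cases hw : ∃ v, k :: v = w
      · have : (leftShift j x) w = 0 := by
          refine wordIsometry_apply_of_notMem List.cons_injective x ?_
          rintro ⟨u, hu⟩
          obtain ⟨v, hv⟩ := hw
          rw [← hv] at hu
          exact h (List.cons.inj hu).1.symm
        simp [this]
      · have : (leftShift k y) w = 0 := wordIsometry_apply_of_notMem List.cons_injective y hw
        simp [this]
    simp only [this, tsum_zero]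
    simp

theorem mem_of_basisVec_mem {d : ℕ} (S : Submodule ℂ (Fock d)) (hS : IsClosed (S : Set (Fock d)))
    (h : ∀ w, basisVec w ∈ S) (f : Fock d) : f ∈ S := by
  have hf := lp.hasSum_single (p := 2) (by norm_num) f
  refine hS.mem_of_tendsto hf (Filter.Eventually.of_forall fun s => ?_)
  refine S.sum_mem fun w _ => ?_
  have : lp.single (E := fun _ : List (Fin d) => ℂ) 2 w (f w) = f w • basisVec w := by
    rw [basisVec, ← lp.single_smul]
    simp
  rw [this]
  exact S.smul_mem _ (h w)

/-! ### The free disk algebra and the free disk system -/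

/-- The free disk algebra `𝒜_d`: the operator-norm closure of the unital algebra generated by
the left free shifts. -/
noncomputable def freeDiskAlgebra (d : ℕ) : Subalgebra ℂ (Fock d →L[ℂ] Fock d) :=
  (Algebra.adjoin ℂ (Set.range (leftShift (d := d)))).topologicalClosure

/-- The free disk system: the operator-norm closure of `𝒜_d + 𝒜_d^*`. -/
noncomputable def freeDiskSystem (d : ℕ) : Submodule ℂ (Fock d →L[ℂ] Fock d) :=
  (Subalgebra.toSubmodule (freeDiskAlgebra d) ⊔
    Subalgebra.toSubmodule (star (freeDiskAlgebra d))).topologicalClosure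

theorem mem_system_of_mem {d : ℕ} {a : Fock d →L[ℂ] Fock d} (ha : a ∈ freeDiskAlgebra d) :
    a ∈ freeDiskSystem d :=
  Submodule.le_topologicalClosure _
    (Submodule.mem_sup_left ((Subalgebra.mem_toSubmodule _).2 ha))

theorem mem_system_of_star_mem {d : ℕ} {a : Fock d →L[ℂ] Fock d}
    (ha : star a ∈ freeDiskAlgebra d) : a ∈ freeDiskSystem d :=
  Submodule.le_topologicalClosure _
    (Submodule.mem_sup_right ((Subalgebra.mem_toSubmodule _).2 ((Subalgebra.mem_star_iff _ _).2 ha)))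

theorem star_word_mul_word_mem {d : ℕ} {x y : Fock d →L[ℂ] Fock d}
    (hx : x ∈ Submonoid.closure (Set.range (leftShift (d := d))))
    (hy : y ∈ Submonoid.closure (Set.range (leftShift (d := d)))) :
    star x * y ∈ freeDiskSystem d := by
  have hA : ∀ z ∈ Submonoid.closure (Set.range (leftShift (d := d))), z ∈ freeDiskAlgebra d := by
    intro z hz
    refine Subalgebra.le_topologicalClosure _ ?_
    have : Submonoid.closure (Set.range (leftShift (d := d))) ≤
        (Algebra.adjoin ℂ (Set.range (leftShift (d := d)))).toSubmonoid :=
      Submonoid.closure_le.2 Algebra.subset_adjoin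
    exact this hz
  induction hx using Submonoid.closure_induction_left generalizing y with
  | one => simpa using mem_system_of_mem (hA y hy)
  | mul_left l hl x' hx' ih =>
    obtain ⟨k, rfl⟩ := hl
    have key : star (leftShift k * x') * y = star x' * (star (leftShift k) * y) := by
      rw [star_mul, mul_assoc]
    induction hy using Submonoid.closure_induction_left with
    | one =>
      refine mem_system_of_star_mem ?_
      simpa using hA _ (Submonoid.mul_mem _ (Submonoid.subset_closure ⟨k, rfl⟩) hx')
    | mul_left l' hl' y' hy' _ =>
      obtain ⟨j, rfl⟩ := hl'
      rw [key, ← mul_assoc (star (leftShift k)), star_leftShift_mul]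
      split_ifs
      · simpa using ih hy'
      · simp

/-- The semi-Dirichlet property `𝒜_d^* 𝒜_d ⊆ (𝒜_d + 𝒜_d^*)^{-‖·‖}`. -/
theorem star_mul_mem_system {d : ℕ} {a b : Fock d →L[ℂ] Fock d}
    (ha : a ∈ freeDiskAlgebra d) (hb : b ∈ freeDiskAlgebra d) :
    star a * b ∈ freeDiskSystem d := by
  have hcl : IsClosed (freeDiskSystem d : Set (Fock d →L[ℂ] Fock d)) :=
    Submodule.isClosed_topologicalClosure _
  have hpoly : ∀ a ∈ Algebra.adjoin ℂ (Set.range (leftShift (d := d))),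
      ∀ b ∈ Algebra.adjoin ℂ (Set.range (leftShift (d := d))),
        star a * b ∈ freeDiskSystem d := by
    intro a ha b hb
    rw [← Subalgebra.mem_toSubmodule, Algebra.adjoin_eq_span] at ha hb
    induction ha using Submodule.span_induction with
    | mem x hx =>
      induction hb using Submodule.span_induction with
      | mem y hy => exact star_word_mul_word_mem hx hy
      | zero => simp
      | add y z _ _ hy hz => rw [mul_add]; exact Submodule.add_mem _ hy hz
      | smul c y _ hy => rw [mul_smul_comm]; exact Submodule.smul_mem _ _ hy
    | zero => simp
    | add y z _ _ hy hz => rw [star_add, add_mul]; exact Submodule.add_mem _ hy hz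
    | smul c y _ hy => rw [star_smul, smul_mul_assoc]; exact Submodule.smul_mem _ _ hy
  have hcont : Continuous
      (Function.uncurry fun a b : Fock d →L[ℂ] Fock d => star a * b) := by
    simp only [Function.uncurry_def]
    fun_prop
  have := map_mem_closure₂ (u := (freeDiskSystem d : Set (Fock d →L[ℂ] Fock d))) hcont ha hb hpoly
  rwa [hcl.closure_eq] at this

/-! ### NC measures -/

/-- A (positive) NC measure: a positive linear functional on the free disk system. -/
structure NCMeasure (d : ℕ) where
  toLinearMap : freeDiskSystem d →ₗ[ℂ] ℂ
  nonneg : ∀ x : freeDiskSystem d, 0 ≤ (x : Fock d →L[ℂ] Fock d) → 0 ≤ toLinearMap x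

/-- The sum of two NC measures. -/
noncomputable instance instAddNCMeasure (d : ℕ) : Add (NCMeasure d) where
  add μ ν :=
    { toLinearMap := μ.toLinearMap + ν.toLinearMap
      nonneg := fun x hx => add_nonneg (μ.nonneg x hx) (ν.nonneg x hx) }

/-- NC Lebesgue measure `m`: the vacuum state `T ↦ ⟨1, T 1⟩`. -/
noncomputable def lebesgue (d : ℕ) : NCMeasure d where
  toLinearMap :=
    { toFun := fun T => ⟪vacuum d, (T : Fock d →L[ℂ] Fock d) (vacuum d)⟫_ℂ
      map_add' := fun S T => by simp
      map_smul' := fun c T => by simp }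
  nonneg := fun T hT =>
    ((ContinuousLinearMap.nonneg_iff_isPositive _).1 hT).inner_nonneg_right _

/-- The product `a^* b` of elements of the free disk algebra, as an element of the free disk
system. -/
noncomputable def starMul {d : ℕ} (a b : freeDiskAlgebra d) : freeDiskSystem d :=
  ⟨star (a : Fock d →L[ℂ] Fock d) * b, star_mul_mem_system a.2 b.2⟩

/-- The sesquilinear form `(a, b) ↦ μ(a^* b)` on the free disk algebra. -/
noncomputable def NCMeasure.sesq {d : ℕ} (μ : NCMeasure d) :
    freeDiskAlgebra d →ₗ⋆[ℂ] freeDiskAlgebra d →ₗ[ℂ] ℂ :=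
  LinearMap.mk₂'ₛₗ (starRingEnd ℂ) (RingHom.id ℂ) (fun a b => μ.toLinearMap (starMul a b))
    (fun a b c => by
      rw [← map_add]; congr 1; ext1; simp [starMul, add_mul])
    (fun c a b => by
      rw [← map_smul]; congr 1; ext1; simp [starMul])
    (fun a b c => by
      rw [← map_add]; congr 1; ext1; simp [starMul, mul_add])
    (fun c a b => by
      simp only [RingHom.id_apply]
      rw [← map_smul]; congr 1; ext1; simp [starMul])

theorem NCMeasure.sesq_apply {d : ℕ} (μ : NCMeasure d) (a b : freeDiskAlgebra d) :
    μ.sesq a b = μ.toLinearMap (starMul a b) := rfl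

theorem NCMeasure.sesq_nonneg {d : ℕ} (μ : NCMeasure d) (a : freeDiskAlgebra d) :
    0 ≤ μ.sesq a a := by
  refine μ.nonneg _ ?_
  rw [ContinuousLinearMap.nonneg_iff_isPositive]
  exact ContinuousLinearMap.isPositive_adjoint_comp_self _

theorem NCMeasure.sesq_conj {d : ℕ} (μ : NCMeasure d) (a b : freeDiskAlgebra d) :
    (starRingEnd ℂ) (μ.sesq b a) = μ.sesq a b := by
  have h1 := (Complex.nonneg_iff.1 (μ.sesq_nonneg a)).2
  have h2 := (Complex.nonneg_iff.1 (μ.sesq_nonneg b)).2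
  have h3 := (Complex.nonneg_iff.1 (μ.sesq_nonneg (a + b))).2
  have h4 := (Complex.nonneg_iff.1 (μ.sesq_nonneg (a + Complex.I • b))).2
  simp only [map_add, LinearMap.add_apply, LinearMap.map_smulₛₗ, LinearMap.smul_apply,
    smul_eq_mul, Complex.add_im, Complex.mul_im, Complex.conj_I, Complex.neg_re, Complex.neg_im,
    Complex.I_re, Complex.I_im, RingHom.id_apply, Complex.mul_re, Complex.add_re, neg_mul,
    Complex.neg_re, Complex.neg_im] at h3 h4
  apply Complex.ext
  · rw [Complex.conj_re]; linarith
  · rw [Complex.conj_im]; linarith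

/-! ### The GNS space -/

/-- The free disk algebra with the pre-inner product `⟨a, b⟩_μ = μ(a^* b)` (type synonym). -/
@[nolint unusedArguments]
def NCMeasure.PreGNS {d : ℕ} (_μ : NCMeasure d) : Type := freeDiskAlgebra d

noncomputable instance {d : ℕ} (μ : NCMeasure d) : AddCommGroup μ.PreGNS :=
  inferInstanceAs (AddCommGroup (freeDiskAlgebra d))

noncomputable instance {d : ℕ} (μ : NCMeasure d) : Module ℂ μ.PreGNS :=
  inferInstanceAs (Module ℂ (freeDiskAlgebra d))

/-- The identity map from the free disk algebra to its synonym `μ.PreGNS`. -/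
noncomputable def NCMeasure.toPreGNS {d : ℕ} (μ : NCMeasure d) :
    freeDiskAlgebra d ≃ₗ[ℂ] μ.PreGNS := LinearEquiv.refl ℂ _

/-- The GNS pre-inner product. -/
@[reducible]
noncomputable def NCMeasure.preGNSCore {d : ℕ} (μ : NCMeasure d) :
    PreInnerProductSpace.Core ℂ μ.PreGNS where
  inner a b := μ.sesq (μ.toPreGNS.symm a) (μ.toPreGNS.symm b)
  conj_inner_symm a b := μ.sesq_conj _ _
  re_inner_nonneg a := (Complex.nonneg_iff.1 (μ.sesq_nonneg _)).1
  add_left a b c := by simp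
  smul_left a b c := by simp

noncomputable instance {d : ℕ} (μ : NCMeasure d) : SeminormedAddCommGroup μ.PreGNS :=
  InnerProductSpace.Core.toSeminormedAddCommGroup (c := μ.preGNSCore)

noncomputable instance {d : ℕ} (μ : NCMeasure d) : InnerProductSpace ℂ μ.PreGNS :=
  InnerProductSpace.ofCore μ.preGNSCore

/-- The GNS space `ℍ²_d(μ)`: the Hilbert space completion of `𝒜_d` modulo the vectors of zero
length (the completion is Hausdorff, so that it divides these out). -/
abbrev NCMeasure.GNS {d : ℕ} (μ : NCMeasure d) : Type := UniformSpace.Completion μ.PreGNS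

/-- The class `a + N_μ` of `a ∈ 𝒜_d` in the GNS space. -/
noncomputable def NCMeasure.cls {d : ℕ} (μ : NCMeasure d) (a : freeDiskAlgebra d) : μ.GNS :=
  ((μ.toPreGNS a : μ.PreGNS) : UniformSpace.Completion μ.PreGNS)

theorem NCMeasure.inner_cls {d : ℕ} (μ : NCMeasure d) (a b : freeDiskAlgebra d) :
    ⟪μ.cls a, μ.cls b⟫_ℂ = μ.toLinearMap (starMul a b) :=
  UniformSpace.Completion.inner_coe _ _

/-! ### Positive semi-definite forms in a Hilbert space -/

/-- A positive semi-definite sesquilinear form with dense domain in `H`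
(conjugate-linear in the first argument). -/
structure PSDForm (H : Type*) [NormedAddCommGroup H] [InnerProductSpace ℂ H] where
  dom : Submodule ℂ H
  dense_dom : Dense (dom : Set H)
  form : dom →ₗ⋆[ℂ] dom →ₗ[ℂ] ℂ
  nonneg : ∀ x : dom, 0 ≤ form x x

namespace PSDForm

variable {H : Type*} [NormedAddCommGroup H] [InnerProductSpace ℂ H]

/-- The partial order on forms: `p ≤ q` if `Dom q ⊆ Dom p` and `p(h,h) ≤ q(h,h)` on `Dom q`. -/
def BoundedBy (p q : PSDForm H) : Prop :=
  ∃ h : q.dom ≤ p.dom, ∀ x : q.dom,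
    p.form (Submodule.inclusion h x) (Submodule.inclusion h x) ≤ q.form x x

/-- The form `p` extends the form `q`. -/
def Extends (p q : PSDForm H) : Prop :=
  ∃ h : q.dom ≤ p.dom, ∀ x y : q.dom,
    p.form (Submodule.inclusion h x) (Submodule.inclusion h y) = q.form x y

/-- The squared norm `‖x‖²_{q+1} = q(x,x) + ‖x‖²` on the domain of `q`. -/
noncomputable def normSqAddOne (q : PSDForm H) (x : q.dom) : ℝ :=
  (q.form x x).re + ‖(x : H)‖ ^ 2

/-- The form `q` is closed: its domain is complete in the norm `‖·‖_{q+1}`. -/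
def IsClosedForm (q : PSDForm H) : Prop :=
  ∀ u : ℕ → q.dom,
    (∀ ε > 0, ∃ N, ∀ m ≥ N, ∀ n ≥ N, q.normSqAddOne (u m - u n) < ε) →
      ∃ x : q.dom, Filter.Tendsto (fun n => q.normSqAddOne (u n - x)) Filter.atTop (nhds 0)

/-- The form `q` is closable (absolutely continuous): it has a closed extension. -/
def IsClosable (q : PSDForm H) : Prop :=
  ∃ p : PSDForm H, p.IsClosedForm ∧ p.Extends q

/-- `p` is the absolutely continuous part of `q`: the maximal closable form bounded above
by `q`. -/
def IsACPart (p q : PSDForm H) : Prop :=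
  p.IsClosable ∧ p.BoundedBy q ∧ ∀ r : PSDForm H, r.IsClosable → r.BoundedBy q → r.BoundedBy p

/-- The form `q` is singular: its maximal absolutely continuous part vanishes identically. -/
def IsSingular (q : PSDForm H) : Prop :=
  ∃ p : PSDForm H, p.IsACPart q ∧ p.form = 0

end PSDForm

/-! ### The form of an NC measure -/

/-- The embedding `𝒜_d ⊂ ℍ²_d`, `a ↦ a 1`. -/
noncomputable def vacuumMap (d : ℕ) : freeDiskAlgebra d →ₗ[ℂ] Fock d where
  toFun a := (a : Fock d →L[ℂ] Fock d) (vacuum d)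
  map_add' a b := by simp
  map_smul' c a := by simp

theorem append_right_injective {d : ℕ} (v : List (Fin d)) :
    Function.Injective (fun w : List (Fin d) => w ++ v) :=
  fun _ _ h => List.append_cancel_right h

theorem commute_rightShift {d : ℕ} {a : Fock d →L[ℂ] Fock d} (ha : a ∈ freeDiskAlgebra d)
    (v : List (Fin d)) :
    a * (wordIsometry _ (append_right_injective v)).toContinuousLinearMap =
      (wordIsometry _ (append_right_injective v)).toContinuousLinearMap * a := by
  set R := (wordIsometry _ (append_right_injective v)).toContinuousLinearMap with hR
  have hL : ∀ k : Fin d, leftShift k * R = R * leftShift k := by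
    intro k
    ext1 f
    refine mem_of_basisVec_mem (LinearMap.eqLocus (leftShift k * R).toLinearMap
      (R * leftShift k).toLinearMap) ?_ ?_ f
    · exact isClosed_eq (leftShift k * R).continuous (R * leftShift k).continuous
    · intro w
      change leftShift k (R (basisVec w)) = R (leftShift k (basisVec w))
      have h : ∀ u, R (basisVec u) = basisVec (u ++ v) :=
        fun u => wordIsometry_basisVec (append_right_injective v) u
      rw [h, leftShift_basisVec, leftShift_basisVec, h, List.cons_append]
  have hcl : IsClosed {b : Fock d →L[ℂ] Fock d | b * R = R * b} :=
    isClosed_eq (by fun_prop) (by fun_prop)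
  have hsub : ((Algebra.adjoin ℂ (Set.range (leftShift (d := d))) :
      Subalgebra ℂ (Fock d →L[ℂ] Fock d)) : Set (Fock d →L[ℂ] Fock d)) ⊆
      {b | b * R = R * b} := by
    intro b hb
    induction hb using Algebra.adjoin_induction with
    | mem x hx => obtain ⟨k, rfl⟩ := hx; exact hL k
    | algebraMap c => exact Algebra.commutes c R
    | add x y _ _ hx hy =>
      change x * R = R * x at hx
      change y * R = R * y at hy
      change (x + y) * R = R * (x + y)
      rw [add_mul, mul_add, hx, hy]
    | mul x y _ _ hx hy =>
      change x * R = R * x at hx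
      change y * R = R * y at hy
      change x * y * R = R * (x * y)
      rw [mul_assoc, hy, ← mul_assoc, hx, mul_assoc]
  exact closure_minimal hsub hcl ha

theorem vacuumMap_injective (d : ℕ) : Function.Injective (vacuumMap d) := by
  rw [injective_iff_map_eq_zero]
  intro a ha
  change (a : Fock d →L[ℂ] Fock d) (vacuum d) = 0 at ha
  ext1
  ext1 f
  refine mem_of_basisVec_mem (LinearMap.ker (a : Fock d →L[ℂ] Fock d).toLinearMap) ?_ ?_ f
  · exact isClosed_eq (a : Fock d →L[ℂ] Fock d).continuous continuous_const
  · intro w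
    have h1 : (wordIsometry _ (append_right_injective w)).toContinuousLinearMap (vacuum d) =
        basisVec w := wordIsometry_basisVec (append_right_injective w) []
    have h2 := congrArg (fun T : Fock d →L[ℂ] Fock d => T (vacuum d)) (commute_rightShift a.2 w)
    simp only [mul_apply_eq_comp, h1, ha, map_zero] at h2
    exact h2

theorem dense_range_vacuumMap (d : ℕ) :
    Dense ((LinearMap.range (vacuumMap d) : Submodule ℂ (Fock d)) : Set (Fock d)) := by
  intro f
  refine mem_of_basisVec_mem (LinearMap.range (vacuumMap d)).topologicalClosure
    (Submodule.isClosed_topologicalClosure _) (fun w => ?_) f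
  refine Submodule.le_topologicalClosure _ ?_
  induction w with
  | nil => exact ⟨1, rfl⟩
  | cons k w ih =>
    obtain ⟨a, ha⟩ := ih
    have hk : leftShift k ∈ freeDiskAlgebra d :=
      Subalgebra.le_topologicalClosure _ (Algebra.subset_adjoin ⟨k, rfl⟩)
    refine ⟨⟨leftShift k, hk⟩ * a, ?_⟩
    change leftShift k (vacuumMap d a) = _
    rw [ha, leftShift_basisVec]

/-- The embedding `a ↦ a 1` as a linear bijection of `𝒜_d` onto its image in the Fock space. -/
noncomputable def vacuumEquiv (d : ℕ) :
    freeDiskAlgebra d ≃ₗ[ℂ] (LinearMap.range (vacuumMap d) : Submodule ℂ (Fock d)) :=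
  LinearEquiv.ofInjective (vacuumMap d) (vacuumMap_injective d)

/-- The form `q_μ(a, b) = μ(a^* b)` with domain `𝒜_d ⊂ ℍ²_d`, where `a ∈ 𝒜_d` is identified
with the vector `a 1`. -/
noncomputable def NCMeasure.form {d : ℕ} (μ : NCMeasure d) : PSDForm (Fock d) where
  dom := LinearMap.range (vacuumMap d)
  dense_dom := dense_range_vacuumMap d
  form := LinearMap.mk₂'ₛₗ (starRingEnd ℂ) (RingHom.id ℂ)
    (fun x y => μ.sesq ((vacuumEquiv d).symm x) ((vacuumEquiv d).symm y))
    (fun x y z => by simp) (fun c x y => by simp) (fun x y z => by simp) (fun c x y => by simp)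
  nonneg x := μ.sesq_nonneg _

/-- An NC measure is singular (with respect to NC Lebesgue measure) if its form in the Fock
space is singular. -/
def NCMeasure.IsSingular {d : ℕ} (μ : NCMeasure d) : Prop := μ.form.IsSingular

end NCMeas

namespace NCMeas

/-! ### Parallelogram estimates and closable forms -/

namespace PSDForm

variable {H : Type*} [NormedAddCommGroup H] [InnerProductSpace ℂ H]

/-! Since `(μ + m)(a^* a) = ‖a + N_μ‖² + ‖a1‖²`, the map in question is always isometric, so it
extends to a unitary exactly when its range, the graph of `a1 ↦ a + N_μ`, is dense (`norm_graphMap`,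
`exists_linearIsometryEquiv_of_denseRange`). It remains to see that singularity means density of
this graph, which is a fact about any form `q(x, x) = ‖J x‖²` with `J` of dense range
(`isSingular_iff_denseRange`).

A nonzero vector `(k, g)` orthogonal to the graph gives `|⟨g, x⟩| = |⟨k, J x⟩| ≤ ‖k‖ ‖J x‖`, so a
multiple of the bounded rank-one form of `g` is a nonzero closed form below `q`. Conversely, if the
graph is dense, then `(J x, 0)` is a limit of points `(J u_n, u_n)`. A closable `r ≤ q` satisfies
`r(x - u_n) → 0` by domination and `r(u_n) → 0` by closability, hence `r(x, x) = 0`. -/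

theorem re_form_self_nonneg (q : PSDForm H) (x : q.dom) : 0 ≤ (q.form x x).re :=
  (Complex.nonneg_iff.1 (q.nonneg x)).1

theorem re_form_add_add_re_form_sub (q : PSDForm H) (x y : q.dom) :
    (q.form (x + y) (x + y)).re + (q.form (x - y) (x - y)).re =
      2 * ((q.form x x).re + (q.form y y).re) := by
  simp only [map_add, map_sub, LinearMap.add_apply, LinearMap.sub_apply, Complex.add_re,
    Complex.sub_re]
  ring

/-- With the factor 2 this stands in for the triangle inequality of the seminorm of `q`, so no
square roots are needed. -/
theorem re_form_add_le (q : PSDForm H) (x y : q.dom) :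
    (q.form (x + y) (x + y)).re ≤ 2 * ((q.form x x).re + (q.form y y).re) := by
  linarith [q.re_form_add_add_re_form_sub x y, q.re_form_self_nonneg (x - y)]

theorem re_form_sub_le (q : PSDForm H) (x y : q.dom) :
    (q.form (x - y) (x - y)).re ≤ 2 * ((q.form x x).re + (q.form y y).re) := by
  linarith [q.re_form_add_add_re_form_sub x y, q.re_form_self_nonneg (x + y)]

/-- A closable form tends to zero along every sequence that tends to zero in the Hilbert space and
is Cauchy for the form. -/
theorem IsClosable.tendsto_zero {q : PSDForm H} (hq : q.IsClosable) (u : ℕ → q.dom)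
    (hu : Filter.Tendsto (fun n => (u n : H)) Filter.atTop (nhds 0))
    (hc : ∀ ε > 0, ∃ N, ∀ m ≥ N, ∀ n ≥ N, (q.form (u m - u n) (u m - u n)).re < ε) :
    Filter.Tendsto (fun n => (q.form (u n) (u n)).re) Filter.atTop (nhds 0) := by
  obtain ⟨p, hp, hle, hpq⟩ := hq
  have hcau := Metric.cauchySeq_iff.1 hu.cauchySeq
  have hform : ∀ x : q.dom, p.normSqAddOne (Submodule.inclusion hle x) =
      (q.form x x).re + ‖(x : H)‖ ^ 2 := by
    intro x
    rw [normSqAddOne, hpq]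
    rfl
  -- The sequence is Cauchy for the form and in `H`, so it has a limit `y` in the closed extension.
  obtain ⟨y, hy⟩ := hp (fun n => Submodule.inclusion hle (u n)) (by
    intro ε hε
    obtain ⟨N₁, h₁⟩ := hc (ε / 2) (by positivity)
    obtain ⟨N₂, h₂⟩ := hcau (√(ε / 2)) (by positivity)
    refine ⟨max N₁ N₂, fun m hm n hn => ?_⟩
    rw [← map_sub, hform]
    have h₃ := h₁ m (le_of_max_le_left hm) n (le_of_max_le_left hn)
    have h₄ := h₂ m (le_of_max_le_right hm) n (le_of_max_le_right hn)
    rw [dist_eq_norm, Real.lt_sqrt (norm_nonneg _)] at h₄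
    rw [Submodule.coe_sub]
    linarith)
  -- The norm of `p + 1` dominates that of `H`, so `y` is also the limit in `H`, which is 0.
  have hlim : Filter.Tendsto (fun n => ‖(u n : H) - y‖ ^ 2) Filter.atTop (nhds 0) :=
    squeeze_zero (fun n => sq_nonneg _)
      (fun n => le_add_of_nonneg_left (p.re_form_self_nonneg _)) hy
  have hlim' : Filter.Tendsto (fun n => ‖(u n : H) - y‖ ^ 2) Filter.atTop
      (nhds (‖(0 : H) - y‖ ^ 2)) := ((hu.sub_const _).norm).pow 2
  have hy0 : y = 0 := by
    have h := tendsto_nhds_unique hlim' hlim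
    simpa using h
  subst hy0
  simp only [sub_zero, hform] at hy
  exact squeeze_zero (fun n => q.re_form_self_nonneg _)
    (fun n => le_add_of_nonneg_right (sq_nonneg _)) hy

/-! ### Bounded rank-one forms and the zero form -/

/-- The everywhere defined form `(x, y) ↦ ⟨x, g⟩⟨g, y⟩`. -/
noncomputable def rankOne (g : H) : PSDForm H where
  dom := ⊤
  dense_dom := by simp
  form := LinearMap.mk₂'ₛₗ (starRingEnd ℂ) (RingHom.id ℂ)
    (fun x y => ⟪(x : H), g⟫_ℂ * ⟪g, (y : H)⟫_ℂ)
    (fun x y z => by simp [add_mul])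
    (fun c x y => by simp [mul_left_comm, mul_assoc])
    (fun x y z => by simp [mul_add])
    (fun c x y => by simp [mul_left_comm])
  nonneg x := by
    simp only [LinearMap.mk₂'ₛₗ_apply, Complex.nonneg_iff]
    rw [← inner_conj_symm (x : H) g, Complex.conj_mul']
    norm_cast
    exact ⟨sq_nonneg _, rfl⟩

theorem rankOne_form_self (g : H) (x : (rankOne g).dom) :
    (rankOne g).form x x = ((‖⟪g, (x : H)⟫_ℂ‖ ^ 2 : ℝ) : ℂ) := by
  change ⟪(x : H), g⟫_ℂ * ⟪g, (x : H)⟫_ℂ = _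
  rw [← inner_conj_symm (x : H) g, Complex.conj_mul']
  norm_cast

/-- The form is bounded and everywhere defined, so its `+1` norm is equivalent to the norm of the
complete space `H`. -/
theorem isClosedForm_rankOne [CompleteSpace H] (g : H) : (rankOne g).IsClosedForm := by
  intro u hu
  have hN : ∀ x : (rankOne g).dom,
      (rankOne g).normSqAddOne x = ‖⟪g, (x : H)⟫_ℂ‖ ^ 2 + ‖(x : H)‖ ^ 2 := by
    intro x
    rw [normSqAddOne, rankOne_form_self, Complex.ofReal_re]
  have hcau : CauchySeq (fun n => (u n : H)) := by
    rw [Metric.cauchySeq_iff]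
    intro ε hε
    obtain ⟨N, h⟩ := hu (ε ^ 2) (by positivity)
    refine ⟨N, fun m hm n hn => ?_⟩
    have h₁ := h m hm n hn
    rw [hN, Submodule.coe_sub] at h₁
    rw [dist_eq_norm]
    refine lt_of_pow_lt_pow_left₀ 2 hε.le ?_
    linarith [sq_nonneg ‖⟪g, (u m : H) - u n⟫_ℂ‖]
  obtain ⟨y, hy⟩ := cauchySeq_tendsto_of_complete hcau
  refine ⟨⟨y, Submodule.mem_top⟩, ?_⟩
  simp only [hN, Submodule.coe_sub]
  have hc : Continuous fun z : H => ‖⟪g, z - y⟫_ℂ‖ ^ 2 + ‖z - y‖ ^ 2 := by fun_prop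
  have h := (hc.tendsto y).comp hy
  rw [sub_self, inner_zero_right, norm_zero, norm_zero, zero_pow two_ne_zero, add_zero] at h
  exact h

theorem IsClosedForm.isClosable {q : PSDForm H} (hq : q.IsClosedForm) : q.IsClosable :=
  ⟨q, hq, le_rfl, fun _ _ => rfl⟩

/-- The zero form on the domain of `q`. -/
def zeroOn (q : PSDForm H) : PSDForm H where
  dom := q.dom
  dense_dom := q.dense_dom
  form := 0
  nonneg _ := le_rfl

theorem isClosable_zeroOn [CompleteSpace H] (q : PSDForm H) : q.zeroOn.IsClosable := by
  refine ⟨rankOne 0, isClosedForm_rankOne 0, le_top, fun x y => ?_⟩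
  change ⟪(x : H), 0⟫_ℂ * _ = 0
  simp

/-! ### Criteria for singularity -/

/-- A form `q` is singular if and only if every closable form bounded by `q` vanishes on the domain
of `q`. -/
theorem isSingular_iff_forall_closable [CompleteSpace H] (q : PSDForm H) :
    q.IsSingular ↔ ∀ r : PSDForm H, r.IsClosable → ∀ h : q.dom ≤ r.dom,
      (∀ x : q.dom, r.form (Submodule.inclusion h x) (Submodule.inclusion h x) ≤ q.form x x) →
        ∀ x : q.dom, r.form (Submodule.inclusion h x) (Submodule.inclusion h x) = 0 := by
  constructor
  · rintro ⟨p, ⟨-, ⟨hqp, -⟩, hmax⟩, hp0⟩ r hr h hle x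
    obtain ⟨_, hrp⟩ := hmax r hr ⟨h, hle⟩
    refine le_antisymm ?_ (r.nonneg _)
    have h₁ := hrp (Submodule.inclusion hqp x)
    rw [hp0] at h₁
    exact h₁
  · intro hz
    -- The zero form must live on `q.dom` only: a competitor `r` is known to be defined there, but
    -- perhaps nowhere else.
    refine ⟨q.zeroOn, ⟨q.isClosable_zeroOn, ⟨le_rfl, fun x => q.nonneg x⟩, ?_⟩, rfl⟩
    rintro r hr ⟨h, hle⟩
    exact ⟨h, fun x => (hz r hr h hle x).le⟩

/-- If `q(x, x) = ‖J x‖²` with `J` of dense range, then `q` is singular if and only if the graph of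
`J` is dense. -/
theorem isSingular_iff_denseRange [CompleteSpace H] {K : Type*} [NormedAddCommGroup K]
    [InnerProductSpace ℂ K] [CompleteSpace K] (q : PSDForm H) (J : q.dom →ₗ[ℂ] K)
    (hJ : DenseRange J) (hq : ∀ x, (q.form x x).re = ‖J x‖ ^ 2) :
    q.IsSingular ↔ DenseRange fun x : q.dom => WithLp.toLp 2 (J x, (x : H)) := by
  rw [isSingular_iff_forall_closable]
  constructor
  · intro hz
    let T : q.dom →ₗ[ℂ] WithLp 2 (K × H) :=
      (WithLp.linearEquiv 2 ℂ (K × H)).symm.toLinearMap ∘ₗ J.prod q.dom.subtype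
    change DenseRange T
    rw [DenseRange, ← LinearMap.coe_range, Submodule.dense_iff_topologicalClosure_eq_top,
      Submodule.topologicalClosure_eq_top_iff, Submodule.eq_bot_iff]
    intro z hz'
    obtain ⟨k, g⟩ := z
    have horth : ∀ x : q.dom, ⟪J x, k⟫_ℂ + ⟪(x : H), g⟫_ℂ = 0 := fun x =>
      (Submodule.mem_orthogonal _ _).1 hz' (T x) ⟨x, rfl⟩
    have hnorm : ∀ x : q.dom, ‖⟪g, (x : H)⟫_ℂ‖ = ‖⟪k, J x⟫_ℂ‖ := by
      intro x
      rw [norm_inner_symm, norm_inner_symm k, eq_neg_of_add_eq_zero_right (horth x), norm_neg]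
    have hk : k = 0 := by
      by_contra hk
      have hk' : 0 < ‖k‖ := norm_pos_iff.2 hk
      -- With this scaling, Cauchy–Schwarz for `⟪k, J x⟫` puts the rank-one form of `c • g` below
      -- `q`.
      let c : ℂ := ((‖k‖⁻¹ : ℝ) : ℂ)
      have hc : ‖c‖ = ‖k‖⁻¹ := by simp [c]
      have hle : q.dom ≤ (rankOne (c • g)).dom := le_top
      have hr : ∀ x : q.dom, (rankOne (c • g)).form (Submodule.inclusion hle x)
          (Submodule.inclusion hle x) = (((‖k‖⁻¹ * ‖⟪k, J x⟫_ℂ‖) ^ 2 : ℝ) : ℂ) := by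
        intro x
        rw [rankOne_form_self, Submodule.coe_inclusion, inner_smul_left, norm_mul,
          RCLike.norm_conj, hc, hnorm]
      have hzero := hz (rankOne (c • g)) (isClosedForm_rankOne _).isClosable hle (by
        intro x
        rw [hr, Complex.le_def]
        refine ⟨?_, ?_⟩
        · rw [Complex.ofReal_re, hq]
          gcongr
          rw [inv_mul_le_iff₀ hk']
          exact norm_inner_le_norm _ _
        · rw [Complex.ofReal_im]
          exact (Complex.nonneg_iff.1 (q.nonneg x)).2)
      refine hk (hJ.eq_zero_of_inner_left ℂ fun x => ?_)
      have h₁ := hzero x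
      rw [hr, Complex.ofReal_eq_zero] at h₁
      simpa [hk] using h₁
    have hg : g = 0 := by
      refine q.dense_dom.eq_zero_of_inner_right ℂ fun x hx => ?_
      have h₁ := horth ⟨x, hx⟩
      rwa [hk, inner_zero_right, zero_add] at h₁
    rw [hk, hg]
    rfl
  · intro hd r hr h hle x
    -- Density provides `u n → 0` in `H` with `J (u n) → J x`, the opposite of closability.
    obtain ⟨t, htT, ht⟩ := mem_closure_iff_seq_limit.1 (hd (WithLp.toLp 2 (J x, 0)))
    choose u hu using htT
    have ht' : Filter.Tendsto (fun n => (J (u n), (u n : H))) Filter.atTop (nhds (J x, 0)) := by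
      have h₁ := ((WithLp.prod_continuous_ofLp 2 K H).tendsto _).comp ht
      refine h₁.congr fun n => ?_
      rw [Function.comp_apply, ← hu n]
    have hJu : Filter.Tendsto (fun n => J (u n)) Filter.atTop (nhds (J x)) :=
      (continuous_fst.tendsto _).comp ht'
    have hu0 : Filter.Tendsto (fun n => (u n : H)) Filter.atTop (nhds 0) :=
      (continuous_snd.tendsto _).comp ht'
    set i := Submodule.inclusion h
    have hle' : ∀ y : q.dom, (r.form (i y) (i y)).re ≤ ‖J y‖ ^ 2 := fun y =>
      ((Complex.le_def.1 (hle y)).1).trans_eq (hq y)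
    have hdiff : Filter.Tendsto (fun n => (r.form (i (x - u n)) (i (x - u n))).re)
        Filter.atTop (nhds 0) := by
      have h₁ : Filter.Tendsto (fun n => ‖J (x - u n)‖ ^ 2) Filter.atTop (nhds 0) := by
        have h₂ := ((hJu.const_sub (J x)).norm).pow 2
        simpa using h₂
      exact squeeze_zero (fun n => r.re_form_self_nonneg _) (fun n => hle' _) h₁
    have hui : Filter.Tendsto (fun n => (r.form (i (u n)) (i (u n))).re)
        Filter.atTop (nhds 0) := by
      refine hr.tendsto_zero (fun n => i (u n)) hu0 fun ε hε => ?_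
      obtain ⟨N, hN⟩ := Filter.eventually_atTop.1
        -- Writing `u m - u n = (x - u n) - (x - u m)`, the bound `re_form_sub_le` gives less than
        -- `2 (ε/4 + ε/4) = ε`.
        (hdiff.eventually (gt_mem_nhds (show (0 : ℝ) < ε / 4 by positivity)))
      refine ⟨N, fun m hm n hn => ?_⟩
      have h₁ := r.re_form_sub_le (i (x - u n)) (i (x - u m))
      rw [← map_sub i, sub_sub_sub_cancel_left, map_sub i] at h₁
      linarith [hN m hm, hN n hn]
    have hlim : Filter.Tendsto (fun n => 2 * ((r.form (i (x - u n)) (i (x - u n))).re +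
        (r.form (i (u n)) (i (u n))).re)) Filter.atTop (nhds 0) := by
      simpa using (hdiff.add hui).const_mul 2
    have hre : (r.form (i x) (i x)).re ≤ 0 := by
      refine ge_of_tendsto' hlim fun n => ?_
      have h₁ := r.re_form_add_le (i (x - u n)) (i (u n))
      rwa [← map_add i, sub_add_cancel] at h₁
    have hnn := Complex.nonneg_iff.1 (r.nonneg (i x))
    exact Complex.ext (le_antisymm hre hnn.1) hnn.2.symm

end PSDForm

/-! ### GNS spaces and the graph of the class map -/

/-- Two linear maps with dense ranges and equal norms are intertwined by a unitary. -/
theorem exists_linearIsometryEquiv_of_denseRange {A E F : Type*} [AddCommGroup A] [Module ℂ A]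
    [NormedAddCommGroup E] [NormedSpace ℂ E] [CompleteSpace E]
    [NormedAddCommGroup F] [NormedSpace ℂ F] [CompleteSpace F]
    (f : A →ₗ[ℂ] E) (g : A →ₗ[ℂ] F) (hf : DenseRange f) (hg : DenseRange g)
    (h : ∀ a, ‖g a‖ = ‖f a‖) : ∃ U : E ≃ₗᵢ[ℂ] F, ∀ a, U (f a) = g a :=
  ⟨(LinearEquiv.refl ℂ A).extendOfIsometry f g hf hg h,
    LinearEquiv.extendOfIsometry_eq _ _ _ hf hg h⟩

namespace NCMeasure

variable {d : ℕ}

/-- The quotient map `a ↦ a + N_μ` as a linear map into the GNS space. -/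
noncomputable def clsₗ (μ : NCMeasure d) : freeDiskAlgebra d →ₗ[ℂ] μ.GNS :=
  (UniformSpace.Completion.toComplₗᵢ (𝕜 := ℂ) (E := μ.PreGNS)).toLinearMap ∘ₗ
    μ.toPreGNS.toLinearMap

theorem denseRange_cls (μ : NCMeasure d) : DenseRange μ.cls :=
  UniformSpace.Completion.denseRange_coe.comp μ.toPreGNS.surjective.denseRange
    (UniformSpace.Completion.continuous_coe _)

theorem norm_cls_sq (μ : NCMeasure d) (a : freeDiskAlgebra d) :
    ‖μ.cls a‖ ^ 2 = (μ.sesq a a).re := by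
  rw [sesq_apply, ← inner_cls]
  exact norm_sq_eq_re_inner (𝕜 := ℂ) _

theorem sesq_lebesgue (a : freeDiskAlgebra d) :
    ((lebesgue d).sesq a a).re = ‖vacuumMap d a‖ ^ 2 := by
  change (⟪vacuum d, (ContinuousLinearMap.adjoint (a : Fock d →L[ℂ] Fock d))
    ((a : Fock d →L[ℂ] Fock d) (vacuum d))⟫_ℂ).re = _
  rw [ContinuousLinearMap.adjoint_inner_right]
  exact (norm_sq_eq_re_inner (𝕜 := ℂ) _).symm

/-- The map `a ↦ (a + N_μ) ⊕ a1`. -/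
noncomputable def graphMap (μ : NCMeasure d) :
    freeDiskAlgebra d →ₗ[ℂ] WithLp 2 (μ.GNS × Fock d) :=
  (WithLp.linearEquiv 2 ℂ (μ.GNS × Fock d)).symm.toLinearMap ∘ₗ μ.clsₗ.prod (vacuumMap d)

theorem graphMap_apply (μ : NCMeasure d) (a : freeDiskAlgebra d) :
    μ.graphMap a = WithLp.toLp 2 (μ.cls a, vacuumMap d a) := rfl

/-- The Lebesgue part of `μ + m` contributes exactly `‖a1‖²`, by `sesq_lebesgue`. -/
theorem norm_graphMap (μ : NCMeasure d) (a : freeDiskAlgebra d) :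
    ‖μ.graphMap a‖ = ‖(μ + lebesgue d).cls a‖ := by
  rw [← sq_eq_sq₀ (norm_nonneg _) (norm_nonneg _), WithLp.prod_norm_sq_eq_of_L2, norm_cls_sq,
    graphMap_apply]
  change ‖μ.cls a‖ ^ 2 + ‖vacuumMap d a‖ ^ 2 = (μ.sesq a a + (lebesgue d).sesq a a).re
  rw [norm_cls_sq, Complex.add_re, sesq_lebesgue]

/-- The abstract criterion with `J : a1 ↦ a + N_μ`, well defined because `a ↦ a1` is injective; its
graph is the range of `graphMap`. -/
theorem isSingular_iff_denseRange_graphMap (μ : NCMeasure d) :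
    μ.IsSingular ↔ DenseRange μ.graphMap := by
  let e : freeDiskAlgebra d ≃ₗ[ℂ] μ.form.dom := vacuumEquiv d
  have h := PSDForm.isSingular_iff_denseRange μ.form (μ.clsₗ ∘ₗ e.symm.toLinearMap)
    (by
      change DenseRange (μ.cls ∘ e.symm)
      rw [DenseRange, e.symm.surjective.range_comp]
      exact μ.denseRange_cls)
    (fun x => (μ.norm_cls_sq (e.symm x)).symm)
  refine h.trans ?_
  have hcomp : (fun x : μ.form.dom => WithLp.toLp 2
      ((μ.clsₗ ∘ₗ e.symm.toLinearMap) x, (x : Fock d))) = μ.graphMap ∘ e.symm := by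
    funext x
    change _ = WithLp.toLp 2 (μ.cls (e.symm x), ((e (e.symm x) : μ.form.dom) : Fock d))
    rw [e.apply_symm_apply]
    rfl
  rw [hcomp, DenseRange, e.symm.surjective.range_comp, DenseRange]

end NCMeasure

end NCMeas

theorem corollary4p2 (d : ℕ) (μ : NCMeas.NCMeasure d) :
    μ.IsSingular ↔
      ∃ U : (μ + NCMeas.lebesgue d).GNS ≃ₗᵢ[ℂ] WithLp 2 (μ.GNS × NCMeas.Fock d),
        ∀ a : NCMeas.freeDiskAlgebra d,
          U ((μ + NCMeas.lebesgue d).cls a) =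
            WithLp.toLp 2 (μ.cls a, (a : NCMeas.Fock d →L[ℂ] NCMeas.Fock d) (NCMeas.vacuum d)) := by
  rw [NCMeas.NCMeasure.isSingular_iff_denseRange_graphMap]
  have hcls := (μ + NCMeas.lebesgue d).denseRange_cls
  constructor
  · intro hd
    exact NCMeas.exists_linearIsometryEquiv_of_denseRange
      (μ + NCMeas.lebesgue d).clsₗ μ.graphMap hcls hd μ.norm_graphMap
  · rintro ⟨U, hU⟩
    -- A unitary carries the dense set of classes onto a dense set, here the range of `graphMap`.
    have h := U.surjective.denseRange.comp hcls U.continuous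
    rwa [show U ∘ (μ + NCMeas.lebesgue d).cls = (fun a => μ.graphMap a) from funext hU] at h
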